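/- Let $\pi:\mathbb{R}^n\to(\mathbb{R}/\mathbb{Z})^n$ be the quotient map. A $k$-dimensional subtorus of $(\mathbb{R}/\mathbb{Z})^n$ is a subgroup of the form $\pi(W)$, where $W\subseteq\mathbb{R}^n$ is a $k$-dimensional linear subspace spanned by integer vectors. A closed subgroup of $(\mathbb{R}/\mathbb{Z})^n$ has dimension $k$ if it is the direct product of a $k$-dimensional subtorus and a finite subgroup. A subset of $(\mathbb{R}/\mathbb{Z})^n$ is proper if it is not contained in the union of the coordinate hyperplanes $\{x_i=0\}$. For a nonempty closed set $X\subseteq(\mathbb{R}/\mathbb{Z})^n$, let $D(X)$ be the $L^\infty$-distance from $X$ to the point $(1/2,\dots,1/2)$. Let $\mathcal{S}_k(n)$ (respectively $\mathcal{S}_k^*(n)$) be the set of values $D(X)$ as $X$ ranges over the $k$-dimensional proper subtori (respectively the $k$-dimensional proper closed subgroups) of $(\mathbb{R}/\mathbb{Z})^n$, and let $\mathcal{S}_{k,\mathrm{mult}}(n)$ (respectively $\mathcal{S}^*_{k,\mathrm{mult}}(n)$) be the multiset obtained by counting each value $d$ as many times as there are such $X$ with $D(X)=d$. For $\mathcal{S}\subseteq\mathbb{R}$,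 a real number $x$ is an upper (respectively lower) accumulation point of $\mathcal{S}$ if $\mathcal{S}$ meets $(x,x+\varepsilon)$ (respectively $(x-\varepsilon,x)$) for every $\varepsilon>0$. The set $\mathrm{den}(\mathcal{M})$ of density points of a multiset $\mathcal{M}$ of real numbers consists of the accumulation points of its underlying set together with its elements of infinite multiplicity. (a) Let $1\le k<n$. Every accumulation point of $\mathcal{S}_k(n)$ is an upper accumulation point and not a lower accumulation point of $\mathcal{S}_k(n)$, and $\mathrm{den}(\mathcal{S}_{k,\mathrm{mult}}(n))\subseteq\mathcal{S}_{k+1}(n)$. Moreover, for every sequence $T_1,T_2,\dots$ of pairwise distinct $k$-dimensional subtori of $(\mathbb{R}/\mathbb{Z})^n$ there are a subtorus $U$ of dimension at least $k+1$ and a subsequence $T_{i_1},T_{i_2},\dots$ such that every $T_{i_j}$ is contained in $U$ and, for every $\varepsilon>0$, $T_{i_j}$ is $\varepsilon$-dense in $U$ for all sufficiently large $j$. (b) Let $0\le k<n$. Every accumulation point of $\mathcal{S}^*_k(n)$ is an upper accumulation point and not a lower accumulation point of $\mathcal{S}^*_k(n)$, and $\mathrm{den}(\mathcal{S}^*_{k,\mathrm{mult}}(n))\subseteq\mathcal{S}^*_{k+1}(n)$.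 -/

import Mathlib

open Set Filter Topology

noncomputable section

namespace LonelyRunner

/-- The torus `(ℝ/ℤ)^n`; its (product) metric is the `L^∞` metric. -/
abbrev Torus (n : ℕ) : Type := Fin n → UnitAddCircle

/-- The quotient map `π : ℝ^n → (ℝ/ℤ)^n`. -/
def proj (n : ℕ) : (Fin n → ℝ) →+ Torus n where
  toFun v := fun i => (v i : UnitAddCircle)
  map_zero' := by ext i; simp
  map_add' v w := by ext i; simp

/-- The integer lattice `ℤ^n` inside `ℝ^n`. -/
def intLattice (n : ℕ) : Set (Fin n → ℝ) :=
  Set.range (fun (m : Fin n → ℤ) (i : Fin n) => (m i : ℝ))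

/-- A subspace `W` of `ℝ^n` is rational if it is spanned by its integer points,
i.e. if `ℤ^n ∩ W` is a lattice of full rank in `W`. -/
def IsRational {n : ℕ} (W : Submodule ℝ (Fin n → ℝ)) : Prop :=
  Submodule.span ℝ ((W : Set (Fin n → ℝ)) ∩ intLattice n) = W

/-- `T` is a `k`-dimensional subtorus of `(ℝ/ℤ)^n`: it is `π(W)` for some `k`-dimensional
rational subspace `W` of `ℝ^n` (such a `T` is automatically closed and connected). -/
def IsSubtorus {n : ℕ} (k : ℕ) (T : AddSubgroup (Torus n)) : Prop :=
  ∃ W : Submodule ℝ (Fin n → ℝ), IsRational W ∧ Module.finrank ℝ W = k ∧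
    T = W.toAddSubgroup.map (proj n)

/-- `Δ` is a `k`-dimensional closed subgroup of `(ℝ/ℤ)^n`: it is closed, and it is the
(internal) direct product of a `k`-dimensional subtorus and a finite subgroup.
Every closed subgroup has this form for exactly one `k`. -/
def IsSubgroupOfDim {n : ℕ} (k : ℕ) (Δ : AddSubgroup (Torus n)) : Prop :=
  IsClosed (Δ : Set (Torus n)) ∧
    ∃ T H : AddSubgroup (Torus n), IsSubtorus k T ∧ (H : Set (Torus n)).Finite ∧
      T ⊓ H = ⊥ ∧ T ⊔ H = Δ

/-- `X` is proper if it is not contained in the union of the coordinate hyperplanes. -/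
def IsProper {n : ℕ} (X : Set (Torus n)) : Prop :=
  ¬ X ⊆ ⋃ i : Fin n, {x : Torus n | x i = 0}

/-- The point `(1/2, …, 1/2)`. -/
def centerPt (n : ℕ) : Torus n := fun _ => ((1 / 2 : ℝ) : UnitAddCircle)

/-- `D(X)`, the `L^∞`-distance from `X` to `(1/2, …, 1/2)` (used for nonempty `X` only). -/
def D {n : ℕ} (X : Set (Torus n)) : ℝ := Metric.infDist (centerPt n) X

/-- The spectrum `𝒮_k(n)`. -/
def spec (k n : ℕ) : Set ℝ :=
  {d | ∃ T : AddSubgroup (Torus n),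
    IsSubtorus k T ∧ IsProper (T : Set (Torus n)) ∧ D (T : Set (Torus n)) = d}

/-- The subgroup spectrum `𝒮*_k(n)`. -/
def specStar (k n : ℕ) : Set ℝ :=
  {d | ∃ Δ : AddSubgroup (Torus n),
    IsSubgroupOfDim k Δ ∧ IsProper (Δ : Set (Torus n)) ∧ D (Δ : Set (Torus n)) = d}

/-- The multiset `𝒮_{k,mult}(n)`, given by its multiplicity function: the multiplicity of `d`
is the (possibly infinite) number of `k`-dimensional proper subtori `T` with `D(T) = d`. -/
def specMult (k n : ℕ) : ℝ → ℕ∞ := fun d =>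
  {T : AddSubgroup (Torus n) |
    IsSubtorus k T ∧ IsProper (T : Set (Torus n)) ∧ D (T : Set (Torus n)) = d}.encard

/-- The multiset `𝒮*_{k,mult}(n)`, given by its multiplicity function. -/
def specStarMult (k n : ℕ) : ℝ → ℕ∞ := fun d =>
  {Δ : AddSubgroup (Torus n) |
    IsSubgroupOfDim k Δ ∧ IsProper (Δ : Set (Torus n)) ∧ D (Δ : Set (Torus n)) = d}.encard

/-- The set of accumulation points of a set of reals. -/
def acc (S : Set ℝ) : Set ℝ := {x | AccPt x (𝓟 S)}

/-- `x` is an upper accumulation point of `S`. -/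
def IsUpperAcc (S : Set ℝ) (x : ℝ) : Prop := ∀ ε > 0, (S ∩ Ioo x (x + ε)).Nonempty

/-- `x` is a lower accumulation point of `S`. -/
def IsLowerAcc (S : Set ℝ) (x : ℝ) : Prop := ∀ ε > 0, (S ∩ Ioo (x - ε) x).Nonempty

/-- The density points of a multiset of reals (given by its multiplicity function): the
accumulation points of its underlying set, and its elements of infinite multiplicity. -/
def den (m : ℝ → ℕ∞) : Set ℝ := acc {x | m x ≠ 0} ∪ {x | m x = ⊤}

end LonelyRunner

end

/-! Nonempty closed subsets of the torus form a compact space for the Hausdorff metric, so a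
sequence of distinct closed subgroups `X i` has a convergent subsequence, and its limit `K` is again
a closed subgroup. A subgroup uniformly close to `K` lies in `K`, since the quotient by `K` has no
small subgroups (`exists_pos_le_of_forall_dist_lt`). Hence the `X i` eventually lie in `K` and
become dense in it. The dimension of `K` is strictly larger: a closed subgroup contains only
finitely many closed subgroups of its own dimension.

The function `D` is antitone under inclusion and continuous for Hausdorff convergence, so `D (X i)`
tends to `D K` from above. This excludes accumulation from below and places every density point in
the spectrum of some dimension `l ≥ k + 1`.

To descend from `l` to `k + 1`, the minimum defining `D` is shown to be attained at a torsion point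
(`exists_rational_minimizer`). Such a point lies in a smaller proper subgroup of each dimension
needed, and that subgroup has the same value of `D` (`spec_anti`, `specStar_anti`). -/

namespace LonelyRunner

/-! ### Discreteness of closed subgroups of a real vector space -/

section Discrete

theorem discreteTopology_of_norm_lt {E : Type*} [NormedAddCommGroup E] (L : Submodule ℤ E)
    {δ : ℝ} (hδ : 0 < δ) (h : ∀ x ∈ L, ‖x‖ < δ → x = 0) : DiscreteTopology L := by
  refine discreteTopology_of_isOpen_singleton_zero ?_
  have : ({0} : Set L) = Metric.ball 0 δ := by
    ext x
    simp only [mem_singleton_iff, Metric.mem_ball, dist_zero_right]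
    constructor
    · rintro rfl
      simpa using hδ
    · intro hx
      exact Subtype.ext (h x x.2 hx)
  rw [this]
  exact Metric.isOpen_ball

/-- A closed subgroup of a finite-dimensional real normed space that contains no line is
discrete. -/
theorem exists_norm_lt_eq_zero_of_no_line {E : Type*} [NormedAddCommGroup E] [NormedSpace ℝ E]
    [FiniteDimensional ℝ E] (G : AddSubgroup E) (hG : IsClosed (G : Set E))
    (hline : ∀ u : E, (∀ t : ℝ, t • u ∈ G) → u = 0) :
    ∃ δ > 0, ∀ g ∈ G, ‖g‖ < δ → g = 0 := by
  by_contra! hcon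
  have hpos : ∀ N : ℕ, (0 : ℝ) < 1 / ((N : ℝ) + 1) := fun N => by positivity
  choose g hgG hgN hg0 using fun N : ℕ => hcon _ (hpos N)
  have hgn : ∀ N, 0 < ‖g N‖ := fun N => norm_pos_iff.2 (hg0 N)
  have hlim : Tendsto (fun N => ‖g N‖) atTop (𝓝 0) :=
    squeeze_zero (fun N => norm_nonneg _) (fun N => (hgN N).le)
      tendsto_one_div_add_atTop_nhds_zero_nat
  have hsph : ∀ N, ‖g N‖⁻¹ • g N ∈ Metric.sphere (0 : E) 1 := fun N => by
    simp [norm_smul, inv_mul_cancel₀ (hgn N).ne']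
  obtain ⟨u, hu, φ, hφ, hφu⟩ := (isCompact_sphere (0 : E) 1).tendsto_subseq hsph
  have hu0 : u = 0 := by
    -- The short elements `g` point asymptotically along `u`. The multiple of `g` by `⌊t / ‖g‖⌋` has
    -- length within `‖g‖` of `|t|`, so these elements of `G` tend to `t • u`.
    refine hline u fun t => ?_
    have hmem : ∀ j, ⌊t / ‖g (φ j)‖⌋ • g (φ j) ∈ (G : Set E) := fun j =>
      G.zsmul_mem (hgG _) _
    refine hG.mem_of_tendsto (f := fun j => ⌊t / ‖g (φ j)‖⌋ • g (φ j)) (b := atTop) ?_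
      (Eventually.of_forall hmem)
    have hcoef : Tendsto (fun j => (⌊t / ‖g (φ j)‖⌋ : ℝ) * ‖g (φ j)‖) atTop (𝓝 t) := by
      have hl := hlim.comp hφ.tendsto_atTop
      have hlow : Tendsto (fun j => t - ‖g (φ j)‖) atTop (𝓝 t) := by
        simpa using tendsto_const_nhds.sub hl
      refine tendsto_of_tendsto_of_tendsto_of_le_of_le hlow tendsto_const_nhds ?_ ?_
      · intro j
        have h1 := (Int.sub_one_lt_floor (t / ‖g (φ j)‖)).le
        have h2 := mul_le_mul_of_nonneg_right h1 (hgn (φ j)).le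
        rw [sub_mul, div_mul_cancel₀ _ (hgn _).ne', one_mul] at h2
        exact h2
      · intro j
        have h1 := Int.floor_le (t / ‖g (φ j)‖)
        have h2 := mul_le_mul_of_nonneg_right h1 (hgn (φ j)).le
        rwa [div_mul_cancel₀ _ (hgn _).ne'] at h2
    have := hcoef.smul hφu
    refine this.congr fun j => ?_
    rw [Function.comp_apply, smul_smul, mul_assoc, mul_inv_cancel₀ (hgn _).ne', mul_one,
      Int.cast_smul_eq_zsmul]
  simp [hu0] at hu

end Discrete

/-! ### The projection from Euclidean space to the torus -/

section Proj

variable {n : ℕ}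

theorem proj_apply (v : Fin n → ℝ) (i : Fin n) : proj n v i = (v i : UnitAddCircle) := rfl

theorem continuous_proj : Continuous (proj n) :=
  continuous_pi fun i => (AddCircle.continuous_mk' 1).comp (continuous_apply i)

theorem norm_proj_le (v : Fin n → ℝ) : ‖proj n v‖ ≤ ‖v‖ := by
  refine (pi_norm_le_iff_of_nonneg (norm_nonneg v)).2 fun i => ?_
  refine le_trans ?_ (norm_le_pi_norm v i)
  rw [proj_apply, Real.norm_eq_abs, UnitAddCircle.norm_eq]
  simpa using round_le (v i) 0

theorem exists_proj_eq (x : Torus n) : ∃ v, proj n v = x ∧ ‖v‖ = ‖x‖ := by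
  have h : ∀ i, ∃ r : ℝ, (r : UnitAddCircle) = x i ∧ |r| = ‖x i‖ := by
    intro i
    obtain ⟨s, hs⟩ := QuotientAddGroup.mk_surjective (x i)
    refine ⟨s - round s, ?_, ?_⟩
    · rw [← hs, AddCircle.coe_sub, sub_eq_self, AddCircle.coe_eq_zero_iff]
      exact ⟨round s, by simp⟩
    · rw [← hs]
      exact (UnitAddCircle.norm_eq).symm
  choose v hv hv' using h
  refine ⟨v, funext hv, ?_⟩
  simp only [Pi.norm_def]
  congr 2
  funext i
  exact NNReal.eq (hv' i)

theorem proj_eq_zero_iff (v : Fin n → ℝ) : proj n v = 0 ↔ v ∈ intLattice n := by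
  constructor
  · intro h
    have : ∀ i, ∃ m : ℤ, (m : ℝ) = v i := fun i => by
      obtain ⟨m, hm⟩ := (AddCircle.coe_eq_zero_iff (1 : ℝ)).1 (congrFun h i)
      exact ⟨m, by simpa using hm⟩
    choose m hm using this
    exact ⟨m, funext hm⟩
  · rintro ⟨m, rfl⟩
    funext i
    exact (AddCircle.coe_eq_zero_iff (1 : ℝ)).2 ⟨m i, by simp⟩

/-- The inclusion of `ℤ^n` in `ℝ^n`. -/
def intCastMap (n : ℕ) : (Fin n → ℤ) →ₗ[ℤ] (Fin n → ℝ) where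
  toFun m i := (m i : ℝ)
  map_add' a b := by ext i; simp
  map_smul' a b := by ext i; simp

theorem intCastMap_injective : Function.Injective (intCastMap n) := by
  intro a b h
  funext i
  have := congrFun h i
  simpa [intCastMap] using this

theorem range_intCastMap : Set.range (intCastMap n) = intLattice n := rfl

theorem span_intLattice : Submodule.span ℝ (intLattice n) = ⊤ := by
  rw [eq_top_iff, ← (Pi.basisFun ℝ (Fin n)).span_eq]
  refine Submodule.span_mono ?_
  rintro _ ⟨i, rfl⟩
  refine ⟨Pi.single i 1, ?_⟩
  funext j
  by_cases h : j = i
  · subst h; simp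
  · simp [h]

theorem eq_zero_of_mem_intLattice {v : Fin n → ℝ} (hv : v ∈ intLattice n) (h : ‖v‖ < 1) :
    v = 0 := by
  obtain ⟨m, rfl⟩ := hv
  funext i
  have h1 := (norm_le_pi_norm (fun i => (m i : ℝ)) i).trans_lt h
  rw [Real.norm_eq_abs, ← Int.cast_abs, ← Int.cast_one, Int.cast_lt, Int.abs_lt_one_iff] at h1
  simp [h1]

/-- The image of a rational subspace in the torus is compact. -/
theorem isCompact_map_proj {W : Submodule ℝ (Fin n → ℝ)} (hW : IsRational W) :
    IsCompact ((W.toAddSubgroup.map (proj n) : AddSubgroup (Torus n)) : Set (Torus n)) := by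
  obtain ⟨b, hb, hspan, hli⟩ := exists_linearIndependent ℝ ((W : Set (Fin n → ℝ)) ∩ intLattice n)
  rw [hW] at hspan
  have : Fintype b := hli.setFinite.fintype
  choose m hm using fun v : b => (hb v.2).2
  have hm' : ∀ (v : b) j, (m v j : ℝ) = (v : Fin n → ℝ) j := fun v j => congrFun (hm v) j
  -- The basis vectors in `b` are integral, so the linear parametrisation of `W` descends to a
  -- continuous map from a compact torus.
  let Φ : (b → UnitAddCircle) → Torus n := fun c j => ∑ v, m v j • c v
  have hΦ : Continuous Φ := by fun_prop
  have key : ∀ c : b → ℝ, Φ (fun v => (c v : UnitAddCircle)) = proj n (∑ v, c v • (v : Fin n → ℝ)) := by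
    intro c
    funext j
    have : ∀ v : b, m v j • (c v : UnitAddCircle) =
        ((c v * (v : Fin n → ℝ) j : ℝ) : UnitAddCircle) := by
      intro v
      rw [← hm' v j, ← AddCircle.coe_zsmul, zsmul_eq_mul, mul_comm]
    simp only [Φ, this, proj_apply, Finset.sum_apply, Pi.smul_apply, smul_eq_mul]
    exact (map_sum (QuotientAddGroup.mk' (AddSubgroup.zmultiples (1 : ℝ))) _ _).symm
  have hrange : ((W.toAddSubgroup.map (proj n) : AddSubgroup (Torus n)) : Set (Torus n)) =
      Set.range Φ := by
    ext x
    constructor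
    · rintro ⟨w, hw, rfl⟩
      have hw' : w ∈ Submodule.span ℝ (Set.range ((↑) : b → Fin n → ℝ)) := by
        rw [Subtype.range_coe, hspan]; exact hw
      obtain ⟨c, rfl⟩ := (Submodule.mem_span_range_iff_exists_fun ℝ).1 hw'
      exact ⟨_, key c⟩
    · rintro ⟨c, rfl⟩
      choose c' hc' using fun v => QuotientAddGroup.mk_surjective (c v)
      have : c = fun v => (c' v : UnitAddCircle) := funext fun v => (hc' v).symm
      rw [this, key]
      exact ⟨_, W.sum_mem fun v _ => W.smul_mem _ (hb v.2).1, rfl⟩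
  rw [hrange]
  exact isCompact_range hΦ

end Proj

/-! ### Structure of closed subgroups of the torus -/

section Structure

variable {n : ℕ}

/-- The largest linear subspace whose image in the torus lies in `K`. -/
def lineSpace (K : AddSubgroup (Torus n)) : Submodule ℝ (Fin n → ℝ) where
  carrier := {v | ∀ t : ℝ, proj n (t • v) ∈ K}
  add_mem' ha hb t := by rw [smul_add, map_add]; exact K.add_mem (ha t) (hb t)
  zero_mem' t := by rw [smul_zero, map_zero]; exact K.zero_mem
  smul_mem' c v hv t := by rw [smul_smul]; exact hv _

theorem proj_mem_of_mem_lineSpace {K : AddSubgroup (Torus n)} {v : Fin n → ℝ}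
    (hv : v ∈ lineSpace K) : proj n v ∈ K := by simpa using hv 1

theorem map_lineSpace_le (K : AddSubgroup (Torus n)) :
    (lineSpace K).toAddSubgroup.map (proj n) ≤ K := by
  rintro _ ⟨v, hv, rfl⟩
  exact proj_mem_of_mem_lineSpace hv

theorem le_lineSpace {K : AddSubgroup (Torus n)} {W : Submodule ℝ (Fin n → ℝ)}
    (h : W.toAddSubgroup.map (proj n) ≤ K) : W ≤ lineSpace K :=
  fun _ hw t => h ⟨_, W.smul_mem t hw, rfl⟩

/-- The quotient of a closed subgroup of `ℝ^n` by its largest linear subspace is discrete. -/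
theorem exists_quotient_discrete {K : AddSubgroup (Torus n)} (hK : IsClosed (K : Set (Torus n))) :
    ∃ (d : ℕ) (f : (Fin n → ℝ) →ₗ[ℝ] (Fin d → ℝ)), Function.Surjective f ∧
      LinearMap.ker f = lineSpace K ∧
      ∃ δ > 0, ∀ v, proj n v ∈ K → ‖f v‖ < δ → f v = 0 := by
  let V := lineSpace K
  let e := (Module.finBasis ℝ ((Fin n → ℝ) ⧸ V)).equivFun
  let f : (Fin n → ℝ) →ₗ[ℝ] (Fin (Module.finrank ℝ ((Fin n → ℝ) ⧸ V)) → ℝ) :=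
    e.toLinearMap ∘ₗ V.mkQ
  have hsurj : Function.Surjective f := e.surjective.comp V.mkQ_surjective
  have hker : LinearMap.ker f = V := by
    rw [LinearEquiv.ker_comp, Submodule.ker_mkQ]
  refine ⟨_, f, hsurj, hker, ?_⟩
  let G : AddSubgroup (Fin n → ℝ) := K.comap (proj n)
  let G' := G.map f.toAddMonoidHom
  -- The preimage of `K` is a union of cosets of `ker f`, so `f` loses no information about it; as
  -- `f` is open, `G'` inherits closedness.
  have hmem : ∀ v, f v ∈ G' ↔ proj n v ∈ K := by
    intro v
    constructor
    · rintro ⟨w, hw, hwv⟩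
      have h1 : v - w ∈ V := by
        rw [← hker, LinearMap.mem_ker, map_sub, sub_eq_zero]
        exact hwv.symm
      have h2 := K.add_mem (proj_mem_of_mem_lineSpace h1) hw
      rwa [← map_add, sub_add_cancel] at h2
    · intro hv
      exact ⟨v, hv, rfl⟩
  have hclosed : IsClosed (G' : Set (Fin (Module.finrank ℝ ((Fin n → ℝ) ⧸ V)) → ℝ)) := by
    rw [← isOpen_compl_iff]
    have : (G' : Set _)ᶜ = f '' ((proj n) ⁻¹' (K : Set (Torus n)))ᶜ := by
      ext y
      obtain ⟨v, rfl⟩ := hsurj y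
      constructor
      · intro hy
        exact ⟨v, fun h => hy ((hmem v).2 h), rfl⟩
      · rintro ⟨w, hw, hwv⟩ hy
        rw [← hwv] at hy
        exact hw ((hmem w).1 hy)
    rw [this]
    exact f.isOpenMap_of_finiteDimensional hsurj _ (hK.preimage continuous_proj).isOpen_compl
  obtain ⟨δ, hδ, h⟩ := exists_norm_lt_eq_zero_of_no_line G' hclosed (by
    intro u hu
    obtain ⟨v, rfl⟩ := hsurj u
    have : v ∈ V := fun t => (hmem _).1 (by rw [map_smul]; exact hu t)
    rwa [← hker] at this)
  exact ⟨δ, hδ, fun v hv => h _ ((hmem v).2 hv)⟩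

theorem exists_norm_lt_mem_lineSpace {K : AddSubgroup (Torus n)}
    (hK : IsClosed (K : Set (Torus n))) :
    ∃ δ > 0, ∀ v, proj n v ∈ K → ‖v‖ < δ → v ∈ lineSpace K := by
  obtain ⟨d, f, -, hker, δ, hδ, h⟩ := exists_quotient_discrete hK
  have hf : Continuous f := f.continuous_of_finiteDimensional
  obtain ⟨η, hη, hη'⟩ := Metric.continuousAt_iff.1 (hf.continuousAt (x := 0)) δ hδ
  refine ⟨η, hη, fun v hv hvη => ?_⟩
  rw [← hker]
  refine h v hv ?_
  have := hη' (x := v) (by simpa using hvη)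
  simpa using this

/-- Rank count: the image of `ℤ^n` under `f` is discrete and spans `ℝ^d`, so it has rank `d`. The
integer points of `ker f` therefore have rank `n - d`, which is the dimension of `lineSpace K`. -/
theorem isRational_lineSpace {K : AddSubgroup (Torus n)} (hK : IsClosed (K : Set (Torus n))) :
    IsRational (lineSpace K) := by
  obtain ⟨d, f, hsurj, hker, δ, hδ, h⟩ := exists_quotient_discrete hK
  set V := lineSpace K
  let g : (Fin n → ℤ) →ₗ[ℤ] (Fin d → ℝ) := (f.restrictScalars ℤ) ∘ₗ intCastMap n
  have hrn : Module.finrank ℤ (LinearMap.range g) + Module.finrank ℤ (LinearMap.ker g) = n := by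
    rw [← g.quotKerEquivRange.finrank_eq, Submodule.finrank_quotient_add_finrank]
    simp
  have hA : Module.finrank ℤ (LinearMap.range g) = d := by
    have hs : Submodule.span ℤ (Set.range g) = LinearMap.range g := by
      rw [← LinearMap.coe_range, Submodule.span_eq]
    have hdisc : DiscreteTopology (Submodule.span ℤ (Set.range g)) := by
      rw [hs]
      refine discreteTopology_of_norm_lt _ hδ ?_
      rintro _ ⟨m, rfl⟩ hm
      refine h _ ?_ hm
      rw [show proj n (intCastMap n m) = 0 from (proj_eq_zero_iff _).2 ⟨m, rfl⟩]
      exact K.zero_mem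
    have := Real.finrank_eq_int_finrank_of_discrete hdisc
    rw [Set.finrank, Set.finrank, hs] at this
    rw [← this]
    have htop : Submodule.span ℝ (Set.range g) = ⊤ := by
      have : Set.range g = f '' intLattice n := by
        rw [← range_intCastMap, ← Set.range_comp]; rfl
      rw [this, Submodule.span_image, span_intLattice, Submodule.map_top,
        LinearMap.range_eq_top.2 hsurj]
    rw [htop]
    simp
  have hB : Module.finrank ℤ (LinearMap.ker g) =
      Module.finrank ℝ (Submodule.span ℝ ((V : Set (Fin n → ℝ)) ∩ intLattice n)) := by
    have hset : ((V : Set (Fin n → ℝ)) ∩ intLattice n) =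
        ((LinearMap.ker g).map (intCastMap n) : Submodule ℤ (Fin n → ℝ)) := by
      ext v
      constructor
      · rintro ⟨hv, m, rfl⟩
        refine ⟨m, ?_, rfl⟩
        rw [← hker] at hv
        exact hv
      · rintro ⟨m, hm, rfl⟩
        refine ⟨?_, m, rfl⟩
        rw [← hker]
        exact hm
    have hs : Submodule.span ℤ ((V : Set (Fin n → ℝ)) ∩ intLattice n) =
        (LinearMap.ker g).map (intCastMap n) := by rw [hset, Submodule.span_eq]
    have hdisc : DiscreteTopology
        (Submodule.span ℤ ((V : Set (Fin n → ℝ)) ∩ intLattice n)) := by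
      rw [hs]
      refine discreteTopology_of_norm_lt _ one_pos ?_
      rintro _ ⟨m, -, rfl⟩ hm
      exact eq_zero_of_mem_intLattice ⟨m, rfl⟩ hm
    have := Real.finrank_eq_int_finrank_of_discrete hdisc
    rw [Set.finrank, Set.finrank, hs] at this
    rw [this]
    exact ((LinearMap.ker g).equivMapOfInjective _ intCastMap_injective).finrank_eq
  have hV : d + Module.finrank ℝ V = n := by
    have := f.finrank_range_add_finrank_ker
    rw [hker, LinearMap.range_eq_top.2 hsurj] at this
    simpa using this
  refine Submodule.eq_of_le_of_finrank_eq (Submodule.span_le.2 Set.inter_subset_left) ?_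
  omega

/-- Small elements of `K` lift to small vectors, which lie in `lineSpace K`. The subtorus is thus
open in the compact group `K`. -/
theorem finite_quotient_lineSpace {K : AddSubgroup (Torus n)}
    (hK : IsClosed (K : Set (Torus n))) :
    Finite (K ⧸ ((lineSpace K).toAddSubgroup.map (proj n)).addSubgroupOf K) := by
  have : CompactSpace K := isCompact_iff_compactSpace.1 hK.isCompact
  obtain ⟨δ, hδ, h⟩ := exists_norm_lt_mem_lineSpace hK
  refine AddSubgroup.quotient_finite_of_isOpen _ (AddSubgroup.isOpen_of_mem_nhds _ (g := 0) ?_)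
  refine Filter.mem_of_superset (Metric.ball_mem_nhds (0 : K) hδ) ?_
  intro x hx
  obtain ⟨v, hv, hvn⟩ := exists_proj_eq (x : Torus n)
  have hx' : ‖(x : Torus n)‖ < δ := by simpa using hx
  refine ⟨v, h v ?_ (hvn ▸ hx'), hv⟩
  rw [hv]
  exact x.2

/-- The image of a linear subspace in the torus is a direct factor of every overgroup. -/
theorem exists_complement {W : Submodule ℝ (Fin n → ℝ)} {K : AddSubgroup (Torus n)}
    (hle : W.toAddSubgroup.map (proj n) ≤ K)
    (hfin : Finite (K ⧸ (W.toAddSubgroup.map (proj n)).addSubgroupOf K)) :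
    ∃ H : AddSubgroup (Torus n), (H : Set (Torus n)).Finite ∧
      W.toAddSubgroup.map (proj n) ⊓ H = ⊥ ∧ W.toAddSubgroup.map (proj n) ⊔ H = K := by
  set T := W.toAddSubgroup.map (proj n)
  -- A divisible group is injective over `ℤ`, so the identity of `T` extends to a retraction `r` of
  -- `K`. Its kernel is the complement, and it is finite because it meets each coset of `T` at most
  -- once.
  have hdiv : ∀ {m : ℤ}, m ≠ 0 → Function.Surjective (fun x : T => m • x) := by
    rintro m hm ⟨_, w, hw, rfl⟩
    refine ⟨⟨proj n ((m : ℝ)⁻¹ • w), _, W.smul_mem _ hw, rfl⟩, ?_⟩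
    apply Subtype.ext
    change m • proj n ((m : ℝ)⁻¹ • w) = proj n w
    rw [← map_zsmul, ← Int.cast_smul_eq_zsmul ℝ, smul_smul,
      mul_inv_cancel₀ (Int.cast_ne_zero.2 hm), one_smul]
  let _ : DivisibleBy T ℤ := divisibleByOfSMulRightSurj T ℤ hdiv
  obtain ⟨r, hr⟩ := (Module.Baer.of_divisible T).extension_property_addMonoidHom
    (AddSubgroup.inclusion hle) (AddSubgroup.inclusion_injective hle) (AddMonoidHom.id T)
  have hr' : ∀ t : T, r (AddSubgroup.inclusion hle t) = t := fun t => DFunLike.congr_fun hr t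
  refine ⟨r.ker.map K.subtype, ?_, ?_, ?_⟩
  · rw [AddSubgroup.coe_map]
    refine Set.Finite.image _ ?_
    refine Set.Finite.of_injOn (f := fun x : K => (x : K ⧸ T.addSubgroupOf K))
      (t := Set.univ) (fun _ _ => trivial) ?_ Set.finite_univ
    intro x hx y hy hxy
    have h1 : -x + y ∈ T.addSubgroupOf K := QuotientAddGroup.eq.1 hxy
    have h2 : r (-x + y) = ⟨_, h1⟩ := hr' ⟨_, h1⟩
    have h3 : r (-x + y) = 0 := r.ker.add_mem (r.ker.neg_mem hx) hy
    rw [h3] at h2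
    have h4 : (-x + y : K) = 0 := Subtype.ext (congrArg Subtype.val h2).symm
    exact neg_add_eq_zero.1 h4
  · rw [eq_bot_iff]
    rintro _ ⟨hx, y, hy, rfl⟩
    have h2 : r y = ⟨_, hx⟩ := hr' ⟨_, hx⟩
    have h3 : r y = 0 := hy
    rw [h3] at h2
    exact (congrArg Subtype.val h2).symm
  · refine le_antisymm (sup_le hle ?_) ?_
    · rintro _ ⟨y, -, rfl⟩
      exact y.2
    · intro x hx
      have h1 : r (⟨x, hx⟩ - AddSubgroup.inclusion hle (r ⟨x, hx⟩)) = 0 := by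
        rw [map_sub, hr', sub_self]
      refine AddSubgroup.mem_sup.2 ⟨r ⟨x, hx⟩, (r ⟨x, hx⟩).2, _, ⟨_, h1, rfl⟩, ?_⟩
      simp

theorem isSubgroupOfDim_of_finite_quotient {W : Submodule ℝ (Fin n → ℝ)} (hW : IsRational W)
    {K : AddSubgroup (Torus n)} (hK : IsClosed (K : Set (Torus n)))
    (hle : W.toAddSubgroup.map (proj n) ≤ K)
    (hfin : Finite (K ⧸ (W.toAddSubgroup.map (proj n)).addSubgroupOf K)) :
    IsSubgroupOfDim (Module.finrank ℝ W) K := by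
  obtain ⟨H, h1, h2, h3⟩ := exists_complement hle hfin
  exact ⟨hK, _, H, ⟨W, hW, rfl, rfl⟩, h1, h2, h3⟩

/-- Every closed subgroup of the torus has a dimension. -/
theorem isSubgroupOfDim_lineSpace {K : AddSubgroup (Torus n)}
    (hK : IsClosed (K : Set (Torus n))) :
    IsSubgroupOfDim (Module.finrank ℝ (lineSpace K)) K :=
  isSubgroupOfDim_of_finite_quotient (isRational_lineSpace hK) hK (map_lineSpace_le K)
    (finite_quotient_lineSpace hK)

end Structure

/-! ### Hausdorff limits of subgroups and the jump in dimension -/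

section Limits

variable {n : ℕ}

/-- Quotients of the torus have no small subgroups: a subgroup uniformly close to a closed
subgroup `K` is contained in `K`. -/
theorem exists_pos_le_of_forall_dist_lt {K : AddSubgroup (Torus n)}
    (hK : IsClosed (K : Set (Torus n))) :
    ∃ ε > 0, ∀ X : AddSubgroup (Torus n), (∀ x ∈ X, ∃ y ∈ K, dist x y < ε) → X ≤ K := by
  obtain ⟨δ, hδ, h⟩ := exists_norm_lt_mem_lineSpace hK
  refine ⟨δ / 3, by positivity, fun X hX x hx => ?_⟩
  choose y hyK hy using fun m : ℕ => hX (m • x) (X.nsmul_mem hx m)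
  choose e he hen using fun m : ℕ => exists_proj_eq (m • x - y m)
  have hen' : ∀ m, ‖e m‖ < δ / 3 := fun m => by
    rw [hen, ← dist_eq_norm]
    exact hy m
  -- The errors `e` are additive modulo `lineSpace K`: the defect combines three vectors shorter
  -- than `δ / 3` and projects into `K`. Since the `e m` stay bounded, dividing by `m` then forces
  -- `e 1` into the subspace.
  have hV : ∀ m : ℕ, (m : ℝ) • e 1 - e m ∈ lineSpace K := by
    intro m
    induction m with
    | zero =>
      rw [Nat.cast_zero, zero_smul, zero_sub]
      refine Submodule.neg_mem _ (h _ ?_ ((hen' 0).trans (by linarith)))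
      rw [he, zero_smul, zero_sub]
      exact K.neg_mem (hyK 0)
    | succ m ih =>
      have h1 : e m + e 1 - e (m + 1) ∈ lineSpace K := by
        refine h _ ?_ ?_
        · rw [map_sub, map_add, he, he, he]
          have : m • x - y m + (1 • x - y 1) - ((m + 1) • x - y (m + 1)) =
              y (m + 1) - y m - y 1 := by
            rw [add_smul]
            abel
          rw [this]
          exact K.sub_mem (K.sub_mem (hyK _) (hyK _)) (hyK _)
        · calc ‖e m + e 1 - e (m + 1)‖ ≤ ‖e m + e 1‖ + ‖e (m + 1)‖ := norm_sub_le _ _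
            _ ≤ ‖e m‖ + ‖e 1‖ + ‖e (m + 1)‖ := by gcongr; exact norm_add_le _ _
            _ < δ := by linarith [hen' m, hen' 1, hen' (m + 1)]
      have h2 := Submodule.add_mem _ ih h1
      have : (m : ℝ) • e 1 - e m + (e m + e 1 - e (m + 1)) =
          ((m + 1 : ℕ) : ℝ) • e 1 - e (m + 1) := by
        push_cast
        rw [add_smul, one_smul]
        abel
      rwa [this] at h2
  have hclosed : IsClosed (lineSpace K : Set (Fin n → ℝ)) :=
    Submodule.closed_of_finiteDimensional _
  have hmem : ∀ m : ℕ, e 1 - ((m : ℝ) + 1)⁻¹ • e (m + 1) ∈ lineSpace K := by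
    intro m
    have h1 := (lineSpace K).smul_mem (((m : ℝ) + 1)⁻¹) (hV (m + 1))
    have hm : ((m : ℝ) + 1) ≠ 0 := by positivity
    rwa [smul_sub, smul_smul, Nat.cast_add, Nat.cast_one, inv_mul_cancel₀ hm, one_smul] at h1
  have hlim : Tendsto (fun m : ℕ => e 1 - ((m : ℝ) + 1)⁻¹ • e (m + 1)) atTop (𝓝 (e 1)) := by
    have h0 : Tendsto (fun m : ℕ => ((m : ℝ) + 1)⁻¹ • e (m + 1)) atTop (𝓝 0) := by
      refine squeeze_zero_norm (a := fun m : ℕ => (1 / ((m : ℝ) + 1)) * (δ / 3)) (fun m => ?_) ?_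
      · rw [norm_smul, norm_inv, Real.norm_of_nonneg (by positivity), one_div]
        gcongr
        exact (hen' _).le
      · simpa using tendsto_one_div_add_atTop_nhds_zero_nat.mul_const (δ / 3)
    simpa using tendsto_const_nhds.sub h0
  have he1 : e 1 ∈ lineSpace K := hclosed.mem_of_tendsto hlim (Eventually.of_forall hmem)
  have h3 := K.add_mem (proj_mem_of_mem_lineSpace he1) (hyK 1)
  rwa [he, sub_add_cancel, one_smul] at h3

/-- Every sequence of closed subgroups of the torus has a subsequence converging from inside, in
the Hausdorff sense, to a closed subgroup. -/
theorem exists_subseq_le_dense (X : ℕ → AddSubgroup (Torus n))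
    (hX : ∀ i, IsClosed (X i : Set (Torus n))) :
    ∃ (K : AddSubgroup (Torus n)) (φ : ℕ → ℕ), IsClosed (K : Set (Torus n)) ∧ StrictMono φ ∧
      (∀ j, X (φ j) ≤ K) ∧
      ∀ ε > (0 : ℝ), ∃ J : ℕ, ∀ j ≥ J, ∀ x ∈ K, ∃ y ∈ X (φ j), dist x y < ε := by
  let C : ℕ → TopologicalSpace.NonemptyCompacts (Torus n) := fun i =>
    ⟨⟨X i, (hX i).isCompact⟩, ⟨0, (X i).zero_mem⟩⟩
  obtain ⟨L, φ, hφ, hL⟩ := CompactSpace.tendsto_subseq C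
  have hfin : ∀ j, Metric.hausdorffEDist (C (φ j) : Set (Torus n)) L ≠ ⊤ := fun j =>
    Metric.hausdorffEDist_ne_top_of_nonempty_of_bounded (C (φ j)).nonempty L.nonempty
      (C (φ j)).isCompact.isBounded L.isCompact.isBounded
  have hev : ∀ ε > (0 : ℝ), ∃ J : ℕ, ∀ j ≥ J,
      (∀ x ∈ X (φ j), ∃ y ∈ L, dist x y < ε) ∧ (∀ x ∈ L, ∃ y ∈ X (φ j), dist x y < ε) := by
    intro ε hε
    obtain ⟨J, hJ⟩ := Metric.tendsto_atTop.1 hL ε hε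
    refine ⟨J, fun j hj => ?_⟩
    have hd := hJ j hj
    rw [Function.comp_apply, Metric.NonemptyCompacts.dist_eq] at hd
    refine ⟨fun x hx => Metric.exists_dist_lt_of_hausdorffDist_lt hx hd (hfin j), fun x hx => ?_⟩
    obtain ⟨y, hy, hxy⟩ := Metric.exists_dist_lt_of_hausdorffDist_lt' hx hd (hfin j)
    exact ⟨y, hy, by rwa [dist_comm]⟩
  have hLc : IsClosed (L : Set (Torus n)) := L.isCompact.isClosed
  have hsub : ∀ x ∈ L, ∀ y ∈ L, x - y ∈ L := by
    intro x hx y hy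
    rw [← SetLike.mem_coe, ← hLc.closure_eq]
    refine Metric.mem_closure_iff.2 fun ε hε => ?_
    obtain ⟨J, hJ⟩ := hev (ε / 3) (by positivity)
    obtain ⟨h1, h2⟩ := hJ J le_rfl
    obtain ⟨x', hx', hxx⟩ := h2 x hx
    obtain ⟨y', hy', hyy⟩ := h2 y hy
    obtain ⟨z, hz, hzz⟩ := h1 _ ((X (φ J)).sub_mem hx' hy')
    refine ⟨z, hz, ?_⟩
    calc dist (x - y) z ≤ dist (x - y) (x' - y') + dist (x' - y') z := dist_triangle _ _ _
      _ ≤ dist x x' + dist y y' + dist (x' - y') z := by gcongr; exact dist_sub_sub_le _ _ _ _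
      _ < ε := by linarith
  obtain ⟨x₀, hx₀⟩ := L.nonempty
  have hzero : (0 : Torus n) ∈ L := by simpa using hsub x₀ hx₀ x₀ hx₀
  have hneg : ∀ x ∈ L, -x ∈ L := fun x hx => by simpa using hsub 0 hzero x hx
  let K : AddSubgroup (Torus n) :=
    { carrier := L
      zero_mem' := hzero
      neg_mem' := fun {x} hx => hneg x hx
      add_mem' := fun {x y} hx hy => by simpa using hsub x hx (-y) (hneg y hy) }
  -- Past `J₀` the subgroups are within `ε₀` of `K`, hence contained in it; the subsequence starts
  -- there.
  obtain ⟨ε₀, hε₀, hK⟩ := exists_pos_le_of_forall_dist_lt (K := K) hLc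
  obtain ⟨J₀, hJ₀⟩ := hev ε₀ hε₀
  refine ⟨K, fun j => φ (j + J₀), hLc, fun a b hab => hφ (by omega), fun j => ?_, ?_⟩
  · exact hK _ (hJ₀ _ (by omega)).1
  · intro ε hε
    obtain ⟨J, hJ⟩ := hev ε hε
    exact ⟨J, fun j hj => (hJ _ (by omega)).2⟩

theorem IsSubtorus.isClosed {k : ℕ} {T : AddSubgroup (Torus n)} (hT : IsSubtorus k T) :
    IsClosed (T : Set (Torus n)) := by
  obtain ⟨W, hW, -, rfl⟩ := hT
  exact (isCompact_map_proj hW).isClosed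

/-- A subgroup between `T` and `K` is determined by its image in the finite group `K / T`. -/
theorem not_injective_of_between {T K : AddSubgroup (Torus n)}
    (hfin : Finite (K ⧸ T.addSubgroupOf K)) (X : ℕ → AddSubgroup (Torus n))
    (hX : ∀ j, T ≤ X j ∧ X j ≤ K) : ¬ Function.Injective X := by
  intro hinj
  let q : ℕ → Set (K ⧸ T.addSubgroupOf K) := fun j =>
    (fun x : K => (x : K ⧸ T.addSubgroupOf K)) '' {x | (x : Torus n) ∈ X j}
  refine not_injective_infinite_finite q ?_
  have hle : ∀ i j, q i = q j → X i ≤ X j := by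
    intro i j hij x hx
    have hxK := (hX i).2 hx
    have h1 : ((⟨x, hxK⟩ : K) : K ⧸ T.addSubgroupOf K) ∈ q j := hij ▸ ⟨⟨x, hxK⟩, hx, rfl⟩
    obtain ⟨y, hy, hyx⟩ := h1
    have h2 : -y + ⟨x, hxK⟩ ∈ T.addSubgroupOf K := QuotientAddGroup.eq.1 hyx
    have h3 := (X j).add_mem hy ((hX j).1 h2 : -(y : Torus n) + x ∈ X j)
    rwa [add_neg_cancel_left] at h3
  intro i j hij
  exact hinj (le_antisymm (hle i j hij) (hle j i hij.symm))

/-- The subspace of each `T (φ j)` lies in `lineSpace K`, so the image of that space serves as `U`,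
and density is inherited from `K`. Equal dimension would make all these subspaces coincide, against
injectivity. -/
theorem exists_subseq_subtorus {k : ℕ} (T : ℕ → AddSubgroup (Torus n))
    (hinj : Function.Injective T) (hT : ∀ i, IsSubtorus k (T i)) :
    ∃ (l : ℕ) (U : AddSubgroup (Torus n)) (φ : ℕ → ℕ), k + 1 ≤ l ∧ IsSubtorus l U ∧
      StrictMono φ ∧ (∀ j, T (φ j) ≤ U) ∧
      ∀ ε > (0 : ℝ), ∃ J : ℕ, ∀ j ≥ J, ∀ x ∈ U, ∃ y ∈ T (φ j), dist x y < ε := by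
  obtain ⟨K, φ, hK, hφ, hle, hdense⟩ := exists_subseq_le_dense T fun i => (hT i).isClosed
  choose W hW hWk hTW using hT
  have hWV : ∀ j, W (φ j) ≤ lineSpace K := fun j => le_lineSpace (hTW _ ▸ hle j)
  have hleU : ∀ j, T (φ j) ≤ (lineSpace K).toAddSubgroup.map (proj n) := fun j => by
    rw [hTW]
    exact AddSubgroup.map_mono (Submodule.toAddSubgroup_mono (hWV j))
  refine ⟨_, _, φ, ?_, ⟨lineSpace K, isRational_lineSpace hK, rfl, rfl⟩, hφ, hleU, ?_⟩
  · refine Nat.succ_le_of_lt (lt_of_le_of_ne ?_ fun heq => ?_)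
    · rw [← hWk (φ 0)]
      exact Submodule.finrank_mono (hWV 0)
    · have hWeq : ∀ j, W (φ j) = lineSpace K := fun j =>
        Submodule.eq_of_le_of_finrank_eq (hWV j) ((hWk _).trans heq)
      have h01 : T (φ 0) = T (φ 1) := by rw [hTW, hTW, hWeq, hWeq]
      exact absurd (hφ.injective (hinj h01)) (by decide)
  · exact fun ε hε => (hdense ε hε).imp fun J hJ j hj x hx => hJ j hj x (map_lineSpace_le K hx)

/-- If the limit `K` had dimension `k`, every `X (φ j)` would lie between the subtorus of `K` and
`K`, leaving finitely many possibilities. -/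
theorem exists_subseq_subgroup {k : ℕ} (X : ℕ → AddSubgroup (Torus n))
    (hinj : Function.Injective X) (hX : ∀ i, IsSubgroupOfDim k (X i)) :
    ∃ (l : ℕ) (U : AddSubgroup (Torus n)) (φ : ℕ → ℕ), k + 1 ≤ l ∧ IsSubgroupOfDim l U ∧
      StrictMono φ ∧ (∀ j, X (φ j) ≤ U) ∧
      ∀ ε > (0 : ℝ), ∃ J : ℕ, ∀ j ≥ J, ∀ x ∈ U, ∃ y ∈ X (φ j), dist x y < ε := by
  obtain ⟨K, φ, hK, hφ, hle, hdense⟩ := exists_subseq_le_dense X fun i => (hX i).1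
  choose T H hT _ _ hTX using fun i => (hX i).2
  choose W hW hWk hTW using hT
  have hTX' : ∀ i, T i ≤ X i := fun i => hTX i ▸ le_sup_left
  have hWV : ∀ j, W (φ j) ≤ lineSpace K := fun j =>
    le_lineSpace (hTW _ ▸ (hTX' _).trans (hle j))
  refine ⟨_, K, φ, ?_, isSubgroupOfDim_lineSpace hK, hφ, hle, hdense⟩
  refine Nat.succ_le_of_lt (lt_of_le_of_ne ?_ fun heq => ?_)
  · rw [← hWk (φ 0)]
    exact Submodule.finrank_mono (hWV 0)
  · have hWeq : ∀ j, W (φ j) = lineSpace K := fun j =>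
      Submodule.eq_of_le_of_finrank_eq (hWV j) ((hWk _).trans heq)
    refine not_injective_of_between (finite_quotient_lineSpace hK) (fun j => X (φ j))
      (fun j => ⟨?_, hle j⟩) (hinj.comp hφ.injective)
    rw [← hWeq j, ← hTW]
    exact hTX' _

end Limits

/-! ### Replacing real coordinates by rational ones -/

section RationalApproximation

/-- The identity of `ℝ` is a pointwise limit of `ℚ`-linear retractions of `ℝ` onto `ℚ`. -/
theorem exists_ratLinear_tendsto :
    ∃ φ : ℕ → ℝ →ₗ[ℚ] ℚ, (∀ N, φ N 1 = 1) ∧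
      ∀ x, Tendsto (fun N => (φ N x : ℝ)) atTop (𝓝 x) := by
  -- Extend `1` to a Hamel basis and send each basis element to a rational within `1 / (N + 1)` of
  -- it, keeping `1` fixed. Each real involves finitely many basis elements, whence pointwise
  -- convergence.
  have hli : LinearIndepOn ℚ id ({1} : Set ℝ) := LinearIndepOn.singleton one_ne_zero
  let b := Module.Basis.extend hli
  have hq : ∀ (N : ℕ) (i : hli.extend (Set.subset_univ _)), ∃ q : ℚ,
      |(q : ℝ) - b i| ≤ 1 / ((N : ℝ) + 1) ∧ (b i = 1 → q = 1) := by
    intro N i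
    by_cases h : b i = 1
    · refine ⟨1, ?_, fun _ => rfl⟩
      rw [h, Rat.cast_one, sub_self, abs_zero]
      positivity
    · obtain ⟨q, hq⟩ := exists_rat_near (b i) (ε := 1 / ((N : ℝ) + 1)) (by positivity)
      exact ⟨q, by rw [abs_sub_comm]; exact hq.le, fun h' => absurd h' h⟩
  choose q hq hq1 using hq
  refine ⟨fun N => b.constr ℚ (q N), fun N => ?_, fun x => ?_⟩
  · let i₀ : hli.extend (Set.subset_univ _) :=
      ⟨1, Module.Basis.subset_extend hli (Set.mem_singleton 1)⟩
    have hb : b i₀ = 1 := Module.Basis.extend_apply_self hli i₀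
    calc b.constr ℚ (q N) 1 = b.constr ℚ (q N) (b i₀) := by rw [hb]
      _ = 1 := by rw [Module.Basis.constr_basis, hq1 N i₀ hb]
  · have hlim : ∀ i, Tendsto (fun N => (q N i : ℝ)) atTop (𝓝 (b i)) := fun i => by
      rw [tendsto_iff_dist_tendsto_zero]
      exact squeeze_zero (fun N => dist_nonneg) (fun N => hq N i)
        tendsto_one_div_add_atTop_nhds_zero_nat
    have hx : x = ∑ i ∈ (b.repr x).support, ((b.repr x i : ℚ) : ℝ) * b i := by
      conv_lhs => rw [← b.linearCombination_repr x]
      rw [Finsupp.linearCombination_apply, Finsupp.sum]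
      exact Finset.sum_congr rfl fun i _ => Rat.smul_def _ _
    have hφ : ∀ N, ((b.constr ℚ (q N) x : ℚ) : ℝ) =
        ∑ i ∈ (b.repr x).support, ((b.repr x i : ℚ) : ℝ) * (q N i : ℝ) := by
      intro N
      rw [Module.Basis.constr_apply, Finsupp.sum, Rat.cast_sum]
      exact Finset.sum_congr rfl fun i _ => by rw [smul_eq_mul, Rat.cast_mul]
    simp only [hφ]
    conv => rhs; rw [hx]
    exact tendsto_finsetSum _ fun i _ => (hlim i).const_mul _

theorem ratLinear_ratCast {φ : ℝ →ₗ[ℚ] ℚ} (h1 : φ 1 = 1) (q : ℚ) : φ (q : ℝ) = q := by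
  have : (q : ℝ) = q • (1 : ℝ) := by rw [Rat.smul_def, mul_one]
  rw [this, map_smul, h1, smul_eq_mul, mul_one]

theorem ratLinear_intCast_mul (φ : ℝ →ₗ[ℚ] ℚ) (m : ℤ) (t : ℝ) : φ ((m : ℝ) * t) = m * φ t := by
  rw [← zsmul_eq_mul, map_zsmul, zsmul_eq_mul]

/-- Some rational replacement of the coordinates of a vector does not increase its sup norm, or
else the reflected vector has a smaller norm. -/
theorem exists_ratLinear_norm_le {ι : Type*} [Fintype ι] (u : ι → ℝ) :
    ∃ φ : ℝ →ₗ[ℚ] ℚ, φ 1 = 1 ∧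
      (‖fun i => (φ (u i) : ℝ)‖ ≤ ‖u‖ ∨ ‖fun i => 2 * u i - (φ (u i) : ℝ)‖ < ‖u‖) := by
  obtain ⟨φ, h1, hφ⟩ := exists_ratLinear_tendsto
  rcases (norm_nonneg u).eq_or_lt with h0 | hpos
  · refine ⟨φ 0, h1 0, Or.inl ?_⟩
    rw [norm_eq_zero.1 h0.symm]
    simp [← Pi.zero_def]
  set d := ‖u‖ with hd
  have hlt : ∀ i, |u i| < d →
      ∀ᶠ N in atTop, |(φ N (u i) : ℝ)| < d ∧ |2 * u i - (φ N (u i) : ℝ)| < d := by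
    intro i hi
    refine ((hφ (u i)).abs.eventually_lt_const hi).and ?_
    have : Tendsto (fun N => |2 * u i - (φ N (u i) : ℝ)|) atTop (𝓝 |2 * u i - u i|) :=
      (tendsto_const_nhds.sub (hφ (u i))).abs
    rw [two_mul, add_sub_cancel_right, ← two_mul] at this
    exact this.eventually_lt_const hi
  have hall : ∀ᶠ N in atTop, ∀ i, |u i| < d →
      |(φ N (u i) : ℝ)| < d ∧ |2 * u i - (φ N (u i) : ℝ)| < d := by
    rw [eventually_all]
    intro i
    by_cases hi : |u i| < d
    · exact (hlt i hi).mono fun N hN _ => hN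
    · exact Eventually.of_forall fun N h => absurd h hi
  have hd0 : ∀ᶠ N in atTop, 0 < (φ N d : ℝ) := (hφ d).eventually_const_lt hpos
  have hd2 : ∀ᶠ N in atTop, (φ N d : ℝ) < 2 * d :=
    (hφ d).eventually_lt_const (by linarith)
  obtain ⟨N, hN, hN0, hN2⟩ := (hall.and (hd0.and hd2)).exists
  -- Non-extremal coordinates stay below `d` for large `N`, for the replacement and for its
  -- reflection. The extremal ones are all `±d`, so the sign of `φ N d - d` alone decides which
  -- alternative holds.
  have heq : ∀ i, ¬ |u i| < d → u i = d ∨ u i = -d := fun i hi => by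
    have h2 : |u i| ≤ d := norm_le_pi_norm u i
    exact (abs_eq hpos.le).1 (le_antisymm h2 (not_lt.1 hi))
  refine ⟨φ N, h1 N, ?_⟩
  rcases le_or_gt (φ N d : ℝ) d with hle | hgt
  · refine Or.inl ((pi_norm_le_iff_of_nonneg hpos.le).2 fun i => ?_)
    rw [Real.norm_eq_abs]
    by_cases hi : |u i| < d
    · exact (hN i hi).1.le
    · rcases heq i hi with h | h
      · rw [h, abs_of_pos hN0]
        exact hle
      · rw [h, map_neg, Rat.cast_neg, abs_neg, abs_of_pos hN0]
        exact hle
  · refine Or.inr ((pi_norm_lt_iff hpos).2 fun i => ?_)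
    rw [Real.norm_eq_abs]
    by_cases hi : |u i| < d
    · exact (hN i hi).2
    · rw [abs_lt]
      rcases heq i hi with h | h
      · rw [h]
        constructor <;> linarith
      · rw [h, map_neg, Rat.cast_neg]
        constructor <;> linarith

end RationalApproximation

/-! ### Rational subspaces, torsion minimisers and descent in dimension -/

section Subspaces

variable {n : ℕ}

/-- If `w` is a combination of integer vectors with real coefficients `t`, applying `φ`
coordinatewise gives the same combination with coefficients `φ t`. -/
theorem IsRational.ratLinear_mem {W : Submodule ℝ (Fin n → ℝ)} (hW : IsRational W)
    (φ : ℝ →ₗ[ℚ] ℚ) {w : Fin n → ℝ} (hw : w ∈ W) : (fun i => (φ (w i) : ℝ)) ∈ W := by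
  -- As `φ` is not `ℝ`-linear, the scalar `t` is needed for the induction to pass through real
  -- multiples.
  have key : ∀ t : ℝ, (fun i => (φ ((t • w) i) : ℝ)) ∈ W := by
    rw [← hW] at hw
    induction hw using Submodule.span_induction with
    | mem x hx =>
      intro t
      obtain ⟨hxW, m, rfl⟩ := hx
      convert W.smul_mem (φ t : ℝ) hxW using 1
      funext i
      simp only [Pi.smul_apply, smul_eq_mul]
      rw [mul_comm t, ratLinear_intCast_mul]
      push_cast
      ring
    | zero =>
      intro t
      convert W.zero_mem using 1
      funext i
      simp
    | add x y _ _ hx hy =>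
      intro t
      convert W.add_mem (hx t) (hy t) using 1
      funext i
      simp [mul_add]
    | smul a x _ hx =>
      intro t
      rw [smul_smul]
      exact hx _
  simpa using key 1

theorem isRational_span {S : Set (Fin n → ℝ)} (hS : S ⊆ intLattice n) :
    IsRational (Submodule.span ℝ S) :=
  le_antisymm (Submodule.span_le.2 Set.inter_subset_left)
    (Submodule.span_mono fun _ hx => ⟨Submodule.subset_span hx, hS hx⟩)

theorem IsRational.sup {V W : Submodule ℝ (Fin n → ℝ)} (hV : IsRational V) (hW : IsRational W) :
    IsRational (V ⊔ W) := by
  rw [← hV, ← hW, ← Submodule.span_union]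
  exact isRational_span (Set.union_subset Set.inter_subset_right Set.inter_subset_right)

theorem isRational_bot : IsRational (⊥ : Submodule ℝ (Fin n → ℝ)) := by
  rw [← Submodule.span_empty]
  exact isRational_span (Set.empty_subset _)

theorem exists_isRational_between {V W : Submodule ℝ (Fin n → ℝ)} (hV : IsRational V)
    (hW : IsRational W) (hVW : V ≤ W) {k : ℕ} (hVk : Module.finrank ℝ V ≤ k)
    (hkW : k ≤ Module.finrank ℝ W) :
    ∃ U, IsRational U ∧ V ≤ U ∧ U ≤ W ∧ Module.finrank ℝ U = k := by
  induction k, hVk using Nat.le_induction with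
  | base => exact ⟨V, hV, le_rfl, hVW, rfl⟩
  | succ k _ ih =>
    obtain ⟨U, hU, hVU, hUW, hUk⟩ := ih (by omega)
    obtain ⟨v, hv, hvU⟩ : ∃ v ∈ (W : Set (Fin n → ℝ)) ∩ intLattice n, v ∉ U := by
      by_contra! hcon
      have h1 : W ≤ U := by
        rw [← hW]
        exact Submodule.span_le.2 hcon
      have := Submodule.finrank_mono h1
      omega
    refine ⟨U ⊔ Submodule.span ℝ {v},
      hU.sup (isRational_span (Set.singleton_subset_iff.2 hv.2)), hVU.trans le_sup_left,
      sup_le hUW ((Submodule.span_singleton_le_iff_mem _ _).2 hv.1), ?_⟩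
    rw [Submodule.finrank_sup_span_singleton hvU, hUk]

theorem exists_nat_smul_mem_intLattice {w : Fin n → ℝ} (hw : ∀ i, ∃ q : ℚ, (q : ℝ) = w i) :
    ∃ N : ℕ, 0 < N ∧ (N : ℝ) • w ∈ intLattice n := by
  choose q hq using hw
  refine ⟨∏ j, (q j).den, Finset.prod_pos fun j _ => (q j).den_pos, ?_⟩
  have hdvd : ∀ i, ∃ e : ℕ, ∏ j, (q j).den = (q i).den * e := fun i =>
    Finset.dvd_prod_of_mem _ (Finset.mem_univ i)
  choose e he using hdvd
  refine ⟨fun i => e i * (q i).num, funext fun i => ?_⟩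
  have h1 : ((q i : ℚ) : ℝ) * ((q i).den : ℝ) = ((q i).num : ℝ) := by
    exact_mod_cast Rat.mul_den_eq_num (q i)
  simp only [Pi.smul_apply, smul_eq_mul]
  rw [he i, ← hq i]
  push_cast
  rw [← h1]
  ring

theorem isRational_span_singleton {w : Fin n → ℝ} (hw : ∀ i, ∃ q : ℚ, (q : ℝ) = w i) :
    IsRational (Submodule.span ℝ {w}) := by
  obtain ⟨N, hN, hNw⟩ := exists_nat_smul_mem_intLattice hw
  rw [← Submodule.span_singleton_smul_eq (r := (N : ℝ))
    (IsUnit.mk0 _ (Nat.cast_ne_zero.2 hN.ne'))]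
  exact isRational_span (Set.singleton_subset_iff.2 hNw)

theorem isOfFinAddOrder_proj {w : Fin n → ℝ} (hw : ∀ i, ∃ q : ℚ, (q : ℝ) = w i) :
    IsOfFinAddOrder (proj n w) := by
  obtain ⟨N, hN, hNw⟩ := exists_nat_smul_mem_intLattice hw
  refine isOfFinAddOrder_iff_nsmul_eq_zero.2 ⟨N, hN, ?_⟩
  rw [← map_nsmul, proj_eq_zero_iff, ← Nat.cast_smul_eq_nsmul ℝ]
  exact hNw

theorem exists_rat_of_isOfFinAddOrder {v : Fin n → ℝ} (hv : IsOfFinAddOrder (proj n v))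
    (i : Fin n) : ∃ q : ℚ, (q : ℝ) = v i := by
  obtain ⟨N, hN, h⟩ := isOfFinAddOrder_iff_nsmul_eq_zero.1 hv
  rw [← map_nsmul, proj_eq_zero_iff, ← Nat.cast_smul_eq_nsmul ℝ] at h
  obtain ⟨m, hm⟩ := h
  have hmi : (m i : ℝ) = N * v i := congrFun hm i
  refine ⟨m i / N, ?_⟩
  push_cast
  rw [hmi, mul_div_cancel_left₀ _ (Nat.cast_ne_zero.2 hN.ne')]

theorem isOfFinAddOrder_of_mem {H : AddSubgroup (Torus n)} (hH : (H : Set (Torus n)).Finite)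
    {h : Torus n} (hh : h ∈ H) : IsOfFinAddOrder h := by
  refine finite_zmultiples.1 (hH.subset ?_)
  exact AddSubgroup.zmultiples_le_of_mem hh

theorem proj_half : proj n (fun _ => 1 / 2) = centerPt n := rfl

/-- The distance from the centre to a closed subgroup is attained at a torsion point. -/
theorem exists_rational_minimizer {W : Submodule ℝ (Fin n → ℝ)} (hW : IsRational W)
    {H : AddSubgroup (Torus n)} (hH : (H : Set (Torus n)).Finite) :
    ∃ w ∈ W, (∀ i, ∃ q : ℚ, (q : ℝ) = w i) ∧ ∃ h ∈ H,
      dist (centerPt n) (proj n w + h) =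
        D ((W.toAddSubgroup.map (proj n) ⊔ H : AddSubgroup (Torus n)) : Set (Torus n)) := by
  set Δ : AddSubgroup (Torus n) := W.toAddSubgroup.map (proj n) ⊔ H with hΔ
  have hcomp : IsCompact (Δ : Set (Torus n)) := by
    rw [hΔ, AddSubgroup.add_normal]
    exact (isCompact_map_proj hW).add hH.isCompact
  have hmem : ∀ w ∈ W, ∀ h ∈ H, proj n w + h ∈ Δ := fun w hw h hh =>
    AddSubgroup.add_mem_sup ⟨w, hw, rfl⟩ hh
  obtain ⟨p, hp, hpD⟩ := hcomp.exists_infDist_eq_dist ⟨0, Δ.zero_mem⟩ (centerPt n)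
  obtain ⟨_, ⟨w₀, hw₀, rfl⟩, h, hh, hph⟩ := AddSubgroup.mem_sup.1 hp
  obtain ⟨u, hu, hun⟩ := exists_proj_eq (p - centerPt n)
  have hD : D (Δ : Set (Torus n)) = ‖u‖ := by
    rw [hun, ← dist_eq_norm, dist_comm]
    exact hpD
  have hle : ∀ x ∈ Δ, ∀ v, proj n v = x - centerPt n → ‖u‖ ≤ ‖v‖ := by
    intro x hx v hv
    rw [← hD]
    refine (Metric.infDist_le_dist_of_mem hx).trans ?_
    rw [dist_comm, dist_eq_norm, ← hv]
    exact norm_proj_le v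
  -- `s` lifts the torsion element `h`, so it is rational. Hence `u` and `w₀` differ by a rational
  -- vector, which `φ` fixes.
  let s : Fin n → ℝ := (fun _ => 1 / 2) + u - w₀
  have hs : proj n s = h := by
    rw [map_sub, map_add, proj_half, hu, ← hph]
    abel
  have hsq : ∀ i, ∃ q : ℚ, (q : ℝ) = s i :=
    exists_rat_of_isOfFinAddOrder (hs ▸ isOfFinAddOrder_of_mem hH hh)
  obtain ⟨φ, h1, hφ⟩ := exists_ratLinear_norm_le u
  let w : Fin n → ℝ := fun i => (φ (w₀ i) : ℝ)
  have hwW : w ∈ W := hW.ratLinear_mem φ hw₀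
  have hφu : (fun i => (φ (u i) : ℝ)) = u - w₀ + w := by
    funext i
    obtain ⟨q, hq⟩ := hsq i
    have hui : u i = ((q - 1 / 2 : ℚ) : ℝ) + w₀ i := by
      push_cast
      rw [hq]
      simp only [s, Pi.sub_apply, Pi.add_apply]
      ring
    have : φ (u i) = (q - 1 / 2) + φ (w₀ i) := by
      rw [hui, map_add, ratLinear_ratCast h1]
    rw [this]
    simp only [w, Pi.sub_apply, Pi.add_apply]
    rw [hui]
    push_cast
    ring
  have hproj : proj n (fun i => (φ (u i) : ℝ)) = proj n w + h - centerPt n := by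
    rw [hφu, map_add, map_sub, hu, ← hph]
    abel
  have hproj' : proj n (fun i => 2 * u i - (φ (u i) : ℝ)) =
      proj n (w₀ + w₀ - w) + h - centerPt n := by
    have : (fun i => 2 * u i - (φ (u i) : ℝ)) = u + u - (fun i => (φ (u i) : ℝ)) := by
      funext i
      simp only [Pi.sub_apply, Pi.add_apply]
      ring
    rw [this, map_sub, hproj, map_add, hu, map_sub, map_add, ← hph]
    abel
  -- The reflected vector also leads from the centre to a point of `Δ`, so it cannot be strictly
  -- shorter than the minimal `u`.
  have hφ' : ‖fun i => (φ (u i) : ℝ)‖ ≤ ‖u‖ := by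
    refine hφ.resolve_right fun hlt => absurd hlt (not_lt.2 ?_)
    exact hle _ (hmem _ (W.sub_mem (W.add_mem hw₀ hw₀) hwW) h hh) _ hproj'
  refine ⟨w, hwW, fun i => ⟨_, rfl⟩, h, hh, le_antisymm ?_ ?_⟩
  · rw [hD, dist_comm, dist_eq_norm, ← hproj]
    exact (norm_proj_le _).trans hφ'
  · exact Metric.infDist_le_dist_of_mem (hmem w hwW h hh)

/-- On the circle, `0` is the only point at the maximal distance `1 / 2` from `1 / 2`. Properness
can thus be read off from distances to the centre. -/
theorem isProper_iff (X : Set (Torus n)) :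
    IsProper X ↔ ∃ x ∈ X, dist (centerPt n) x < 1 / 2 := by
  have key : ∀ a : UnitAddCircle, a ≠ 0 ↔ dist ((1 / 2 : ℝ) : UnitAddCircle) a < 1 / 2 := by
    intro a
    rw [dist_eq_norm]
    have hle : ‖((1 / 2 : ℝ) : UnitAddCircle) - a‖ ≤ 1 / 2 := by
      simpa using AddCircle.norm_le_half_period (1 : ℝ)
        (x := ((1 / 2 : ℝ) : UnitAddCircle) - a) one_ne_zero
    constructor
    · intro ha
      refine lt_of_le_of_ne hle fun heq => ha ?_
      obtain ⟨r, hr⟩ := QuotientAddGroup.mk_surjective a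
      rw [← hr] at heq ⊢
      have h2 : |(1 / 2 - r) - round (1 / 2 - r)| = 1 / 2 := by
        rw [← UnitAddCircle.norm_eq]
        exact heq
      refine (AddCircle.coe_eq_zero_iff (1 : ℝ)).2 ?_
      rcases (abs_eq (by norm_num)).1 h2 with h | h
      · exact ⟨-round (1 / 2 - r), by
          push_cast [zsmul_eq_mul]
          linarith⟩
      · exact ⟨1 - round (1 / 2 - r), by
          push_cast [zsmul_eq_mul]
          linarith⟩
    · rintro h rfl
      rw [sub_zero] at h
      have := AddCircle.norm_half_period_eq (1 : ℝ)
      rw [abs_one] at this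
      exact absurd this h.ne
  have hx : ∀ x : Torus n, x ∉ (⋃ i : Fin n, {x : Torus n | x i = 0}) ↔
      dist (centerPt n) x < 1 / 2 := by
    intro x
    rw [dist_pi_lt_iff (by norm_num)]
    simp only [mem_iUnion, mem_ofPred_eq, not_exists]
    exact forall_congr' fun i => key (x i)
  rw [IsProper, Set.not_subset]
  exact exists_congr fun x => and_congr_right fun _ => hx x

theorem D_le_of_subset {X Y : Set (Torus n)} (h : X ⊆ Y) (hX : X.Nonempty) : D Y ≤ D X :=
  Metric.infDist_le_infDist_of_subset h hX

theorem isProper_of_dist_eq {X Y : Set (Torus n)} (hX : IsProper X) {p : Torus n} (hp : p ∈ Y)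
    (hpD : dist (centerPt n) p = D X) : IsProper Y := by
  obtain ⟨x, hx, hxd⟩ := (isProper_iff X).1 hX
  refine (isProper_iff Y).2 ⟨p, hp, ?_⟩
  rw [hpD]
  exact (Metric.infDist_le_dist_of_mem hx).trans_lt hxd

theorem D_eq_of_dist_eq {X Y : Set (Torus n)} (h : Y ⊆ X) {p : Torus n} (hp : p ∈ Y)
    (hpD : dist (centerPt n) p = D X) : D Y = D X :=
  le_antisymm (hpD ▸ Metric.infDist_le_dist_of_mem hp) (D_le_of_subset h ⟨p, hp⟩)

/-- A minimiser `proj n w` with `w` rational lies on the image of the rational subspace spanned by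
`w`, which grows inside `W` to dimension `k`. That span may be a line, hence `1 ≤ k`. -/
theorem spec_anti {k l : ℕ} (hk : 1 ≤ k) (hkl : k ≤ l) : spec l n ⊆ spec k n := by
  rintro _ ⟨T, ⟨W, hW, hWl, rfl⟩, hproper, rfl⟩
  obtain ⟨w, hw, hwq, h, hh, hd⟩ :=
    exists_rational_minimizer hW (H := (⊥ : AddSubgroup (Torus n))) (by simp)
  rw [AddSubgroup.mem_bot] at hh
  rw [hh, add_zero, sup_bot_eq] at hd
  obtain ⟨U, hU, hwU, hUW, hUk⟩ := exists_isRational_between (isRational_span_singleton hwq) hW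
    ((Submodule.span_singleton_le_iff_mem _ _).2 hw) (k := k)
    (((finrank_span_le_card ({w} : Set (Fin n → ℝ))).trans (by simp)).trans hk) (hWl ▸ hkl)
  have hp : proj n w ∈ ((U.toAddSubgroup.map (proj n) : AddSubgroup (Torus n)) : Set (Torus n)) :=
    ⟨w, (Submodule.span_singleton_le_iff_mem _ _).1 hwU, rfl⟩
  exact ⟨_, ⟨U, hU, hUk, rfl⟩, isProper_of_dist_eq hproper hp hd, D_eq_of_dist_eq
    (AddSubgroup.map_mono (Submodule.toAddSubgroup_mono hUW)) hp hd⟩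

/-- The sum need not be direct; finite index of the subtorus is enough to produce a complement. -/
theorem isSubgroupOfDim_sup_zmultiples {W : Submodule ℝ (Fin n → ℝ)} (hW : IsRational W)
    {p : Torus n} (hp : IsOfFinAddOrder p) :
    IsSubgroupOfDim (Module.finrank ℝ W)
      (W.toAddSubgroup.map (proj n) ⊔ AddSubgroup.zmultiples p) := by
  have hfin := finite_zmultiples.2 hp
  refine isSubgroupOfDim_of_finite_quotient hW ?_ le_sup_left ?_
  · rw [AddSubgroup.add_normal]
    exact ((isCompact_map_proj hW).add hfin.isCompact).isClosed
  · set T := W.toAddSubgroup.map (proj n)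
    set Δ := T ⊔ AddSubgroup.zmultiples p
    have : Finite (AddSubgroup.zmultiples p) := hfin
    let f : AddSubgroup.zmultiples p → Δ ⧸ T.addSubgroupOf Δ := fun z =>
      ((AddSubgroup.inclusion le_sup_right z : Δ) : Δ ⧸ T.addSubgroupOf Δ)
    refine Finite.of_surjective f fun y => ?_
    obtain ⟨⟨x, hx⟩, rfl⟩ := QuotientAddGroup.mk_surjective y
    obtain ⟨t, ht, z, hz, rfl⟩ := AddSubgroup.mem_sup.1 hx
    refine ⟨⟨z, hz⟩, QuotientAddGroup.eq.2 ?_⟩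
    change -z + (t + z) ∈ T
    simpa using ht

/-- The torsion minimiser generates a finite group, which can be added to any `k`-dimensional
subtorus of the original one without changing the dimension; so `k = 0` is allowed. -/
theorem specStar_anti {k l : ℕ} (hkl : k ≤ l) : specStar l n ⊆ specStar k n := by
  rintro _ ⟨Δ, ⟨-, T, H, ⟨W, hW, hWl, rfl⟩, hH, -, rfl⟩, hproper, rfl⟩
  obtain ⟨w, hw, hwq, h, hh, hd⟩ := exists_rational_minimizer hW hH
  obtain ⟨U, hU, -, hUW, hUk⟩ := exists_isRational_between isRational_bot hW bot_le (k := k)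
    (by simp) (hWl ▸ hkl)
  have hfin : IsOfFinAddOrder (proj n w + h) :=
    (isOfFinAddOrder_proj hwq).add (isOfFinAddOrder_of_mem hH hh)
  have hp : proj n w + h ∈ U.toAddSubgroup.map (proj n) ⊔ AddSubgroup.zmultiples (proj n w + h) :=
    (le_sup_right : AddSubgroup.zmultiples (proj n w + h) ≤ _) (AddSubgroup.mem_zmultiples _)
  refine ⟨_, hUk ▸ isSubgroupOfDim_sup_zmultiples hU hfin, isProper_of_dist_eq hproper hp hd,
    D_eq_of_dist_eq ?_ hp hd⟩
  have hp' : proj n w + h ∈ W.toAddSubgroup.map (proj n) ⊔ H :=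
    AddSubgroup.add_mem_sup ⟨w, hw, rfl⟩ hh
  refine sup_le ?_ (AddSubgroup.zmultiples_le_of_mem hp')
  exact (AddSubgroup.map_mono (Submodule.toAddSubgroup_mono hUW)).trans le_sup_left

end Subspaces

/-! ### From limits of subgroups to accumulation points of spectra -/

section Spectra

variable {n : ℕ}

/-- The spectrum of a class of subgroups of the torus. -/
def specOf (P : AddSubgroup (Torus n) → Prop) : Set ℝ :=
  {d | ∃ X : AddSubgroup (Torus n), P X ∧ IsProper (X : Set (Torus n)) ∧ D (X : Set (Torus n)) = d}

/-- Every sequence of distinct subgroups in the class `P` has a subsequence converging from inside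
to a subgroup in the class `Q`. -/
def LimitsIn (P Q : AddSubgroup (Torus n) → Prop) : Prop :=
  ∀ X : ℕ → AddSubgroup (Torus n), Function.Injective X → (∀ i, P (X i)) →
    ∃ (U : AddSubgroup (Torus n)) (φ : ℕ → ℕ), Q U ∧ StrictMono φ ∧ (∀ j, X (φ j) ≤ U) ∧
      ∀ ε > (0 : ℝ), ∃ J : ℕ, ∀ j ≥ J, ∀ x ∈ U, ∃ y ∈ X (φ j), dist x y < ε

variable {P Q : AddSubgroup (Torus n) → Prop}

theorem LimitsIn.exists_tendsto (h : LimitsIn P Q) (X : ℕ → AddSubgroup (Torus n))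
    (hinj : Function.Injective X) (hX : ∀ i, P (X i))
    (hproper : ∀ i, IsProper (X i : Set (Torus n))) :
    ∃ (d : ℝ) (φ : ℕ → ℕ), d ∈ specOf Q ∧ StrictMono φ ∧
      (∀ j, d ≤ D (X (φ j) : Set (Torus n))) ∧
      Tendsto (fun j => D (X (φ j) : Set (Torus n))) atTop (𝓝 d) := by
  obtain ⟨U, φ, hU, hφ, hle, hdense⟩ := h X hinj hX
  have hge : ∀ j, D (U : Set (Torus n)) ≤ D (X (φ j) : Set (Torus n)) := fun j =>
    D_le_of_subset (hle j) ⟨0, (X (φ j)).zero_mem⟩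
  refine ⟨D (U : Set (Torus n)), φ, ⟨U, hU, fun hsub => ?_, rfl⟩, hφ, hge, ?_⟩
  · exact hproper (φ 0) (Set.Subset.trans (hle 0) hsub)
  · refine Metric.tendsto_atTop.2 fun ε hε => ?_
    obtain ⟨J, hJ⟩ := hdense (ε / 2) (by positivity)
    refine ⟨J, fun j hj => ?_⟩
    obtain ⟨p, hp, hpd⟩ := (Metric.infDist_lt_iff (s := (U : Set (Torus n))) ⟨0, U.zero_mem⟩).1
      (show Metric.infDist (centerPt n) (U : Set (Torus n)) < D (U : Set (Torus n)) + ε / 2 by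
        unfold D; linarith)
    obtain ⟨y, hy, hpy⟩ := hJ j hj p hp
    have h1 : D (X (φ j) : Set (Torus n)) ≤ dist (centerPt n) y :=
      Metric.infDist_le_dist_of_mem hy
    have h2 := dist_triangle (centerPt n) p y
    rw [Real.dist_eq, abs_of_nonneg (sub_nonneg.2 (hge j))]
    linarith

/-- The subset `A` is arbitrary so that `specOf P ∩ Iio x` can be inserted: it has no element above
`x`, so `x` is not an accumulation point of it. -/
theorem LimitsIn.mem_and_exists_gt (h : LimitsIn P Q) {A : Set ℝ} (hA : A ⊆ specOf P) {x : ℝ}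
    (hx : AccPt x (𝓟 A)) : x ∈ specOf Q ∧ ∃ s ∈ A, x < s := by
  rw [accPt_iff_nhds] at hx
  have hex : ∀ N : ℕ, ∃ s ∈ A, s ≠ x ∧ dist s x < 1 / ((N : ℝ) + 1) := fun N => by
    obtain ⟨s, ⟨hs, hsA⟩, hne⟩ := hx _ (Metric.ball_mem_nhds x (ε := 1 / ((N : ℝ) + 1))
      (by positivity))
    exact ⟨s, hsA, hne, hs⟩
  choose s hsA hne hsd using hex
  have hdist : Tendsto (fun N => dist (s N) x) atTop (𝓝 0) :=
    squeeze_zero (fun N => dist_nonneg) (fun N => (hsd N).le)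
      tendsto_one_div_add_atTop_nhds_zero_nat
  -- Strictly increasing inverse distances along a subsequence make the values, and so the chosen
  -- subgroups, pairwise distinct.
  have hinv : Tendsto (fun N => (dist (s N) x)⁻¹) atTop atTop := by
    refine Tendsto.inv_tendsto_nhdsGT_zero (tendsto_nhdsWithin_iff.2 ⟨hdist, ?_⟩)
    exact Eventually.of_forall fun N => dist_pos.2 (hne N)
  obtain ⟨ψ, hψ, hmono⟩ := strictMono_subseq_of_tendsto_atTop hinv
  choose X hXP hXp hXs using fun j => hA (hsA (ψ j))
  have hinj : Function.Injective X := fun i j hij => hmono.injective (by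
    have h1 : s (ψ i) = s (ψ j) := by rw [← hXs i, ← hXs j, hij]
    simp [h1])
  obtain ⟨d, φ, hd, hφ, hge, hlim⟩ := h.exists_tendsto X hinj hXP hXp
  have hlim' : Tendsto (fun j => D (X (φ j) : Set (Torus n))) atTop (𝓝 x) := by
    simp only [hXs]
    exact ((tendsto_iff_dist_tendsto_zero.2 hdist).comp hψ.tendsto_atTop).comp hφ.tendsto_atTop
  obtain rfl := tendsto_nhds_unique hlim hlim'
  refine ⟨hd, s (ψ (φ 0)), hsA _, lt_of_le_of_ne ?_ (hne _).symm⟩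
  rw [← hXs]
  exact hge 0

theorem LimitsIn.upper_and_not_lower (h : LimitsIn P Q) {x : ℝ} (hx : x ∈ acc (specOf P)) :
    IsUpperAcc (specOf P) x ∧ ¬ IsLowerAcc (specOf P) x := by
  have hno : ¬ AccPt x (𝓟 (specOf P ∩ Iio x)) := fun hacc => by
    obtain ⟨-, s, hs, hxs⟩ := h.mem_and_exists_gt Set.inter_subset_left hacc
    exact lt_asymm hxs hs.2
  constructor
  · intro ε hε
    by_contra hemp
    rw [Set.not_nonempty_iff_eq_empty] at hemp
    refine hno (accPt_iff_nhds.2 fun U hU => ?_)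
    obtain ⟨y, ⟨⟨hyU, hyε⟩, hy⟩, hne⟩ := accPt_iff_nhds.1 hx (U ∩ Iio (x + ε))
      (inter_mem hU (Iio_mem_nhds (by linarith)))
    refine ⟨y, ⟨hyU, hy, lt_of_le_of_ne (not_lt.1 fun hxy => ?_) hne⟩, hne⟩
    exact Set.eq_empty_iff_forall_notMem.1 hemp y ⟨hy, hxy, hyε⟩
  · intro hlow
    refine hno (accPt_iff_nhds.2 fun U hU => ?_)
    obtain ⟨ε, hε, hεU⟩ := Metric.mem_nhds_iff.1 hU
    obtain ⟨y, hy, hy1, hy2⟩ := hlow ε hε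
    refine ⟨y, ⟨hεU ?_, hy, hy2⟩, hy2.ne⟩
    rw [Metric.mem_ball, Real.dist_eq, abs_lt]
    constructor <;> linarith

theorem LimitsIn.den_subset (h : LimitsIn P Q) :
    den (fun d => {X : AddSubgroup (Torus n) |
      P X ∧ IsProper (X : Set (Torus n)) ∧ D (X : Set (Torus n)) = d}.encard) ⊆ specOf Q := by
  rintro x (hx | hx)
  · refine (h.mem_and_exists_gt ?_ hx).1
    intro d hd
    exact Set.encard_ne_zero.1 hd
  · have hinf := Set.encard_eq_top_iff.1 hx
    let e := hinf.natEmbedding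
    obtain ⟨d, φ, hd, -, -, hlim⟩ := h.exists_tendsto (fun i => e i)
      (Subtype.val_injective.comp e.injective) (fun i => (e i).2.1) (fun i => (e i).2.2.1)
    have hconst : ∀ i, D ((e i : AddSubgroup (Torus n)) : Set (Torus n)) = x := fun i =>
      (e i).2.2.2
    simp only [hconst] at hlim
    rwa [tendsto_nhds_unique tendsto_const_nhds hlim]

theorem limitsIn_subtorus (k : ℕ) :
    LimitsIn (n := n) (IsSubtorus k) (fun U => ∃ l, k + 1 ≤ l ∧ IsSubtorus l U) := by
  intro X hinj hX
  obtain ⟨l, U, φ, hl, hU, h⟩ := exists_subseq_subtorus X hinj hX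
  exact ⟨U, φ, ⟨l, hl, hU⟩, h⟩

theorem limitsIn_subgroup (k : ℕ) :
    LimitsIn (n := n) (IsSubgroupOfDim k) (fun U => ∃ l, k + 1 ≤ l ∧ IsSubgroupOfDim l U) := by
  intro X hinj hX
  obtain ⟨l, U, φ, hl, hU, h⟩ := exists_subseq_subgroup X hinj hX
  exact ⟨U, φ, ⟨l, hl, hU⟩, h⟩

end Spectra

end LonelyRunner

theorem lemma6p1 (n k : ℕ) (hkn : k < n) :
    (1 ≤ k →
      (∀ x ∈ LonelyRunner.acc (LonelyRunner.spec k n),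
        LonelyRunner.IsUpperAcc (LonelyRunner.spec k n) x ∧
          ¬ LonelyRunner.IsLowerAcc (LonelyRunner.spec k n) x) ∧
      LonelyRunner.den (LonelyRunner.specMult k n) ⊆ LonelyRunner.spec (k + 1) n ∧
      (∀ T : ℕ → AddSubgroup (LonelyRunner.Torus n), Function.Injective T →
        (∀ i, LonelyRunner.IsSubtorus k (T i)) →
        ∃ (l : ℕ) (U : AddSubgroup (LonelyRunner.Torus n)) (φ : ℕ → ℕ),
          k + 1 ≤ l ∧ LonelyRunner.IsSubtorus l U ∧ StrictMono φ ∧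
          (∀ j, T (φ j) ≤ U) ∧
          ∀ ε > (0 : ℝ), ∃ J : ℕ, ∀ j ≥ J, ∀ x ∈ U, ∃ y ∈ T (φ j), dist x y < ε)) ∧
    ((∀ x ∈ LonelyRunner.acc (LonelyRunner.specStar k n),
        LonelyRunner.IsUpperAcc (LonelyRunner.specStar k n) x ∧
          ¬ LonelyRunner.IsLowerAcc (LonelyRunner.specStar k n) x) ∧
      LonelyRunner.den (LonelyRunner.specStarMult k n) ⊆ LonelyRunner.specStar (k + 1) n) := by
  refine ⟨fun _ => ⟨fun x hx => (LonelyRunner.limitsIn_subtorus k).upper_and_not_lower hx,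
    fun d hd => ?_, fun T => LonelyRunner.exists_subseq_subtorus T⟩,
    fun x hx => (LonelyRunner.limitsIn_subgroup k).upper_and_not_lower hx, fun d hd => ?_⟩
  -- The limit may have any dimension `l ≥ k + 1`; the nesting of the spectra brings its value back
  -- to dimension `k + 1`.
  · obtain ⟨U, ⟨l, hl, hU⟩, hd⟩ := (LonelyRunner.limitsIn_subtorus k).den_subset hd
    exact LonelyRunner.spec_anti (by omega) hl ⟨U, hU, hd⟩
  · obtain ⟨U, ⟨l, hl, hU⟩, hd⟩ := (LonelyRunner.limitsIn_subgroup k).den_subset hd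
    exact LonelyRunner.specStar_anti hl ⟨U, hU, hd⟩
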